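/- Let $Z$ be an infinite-dimensional separable real Hilbert space, $C(Z)$ its Clifford algebra (with relations $vw+wv=-2(v,w)$), $\sigma$ an isometric complex structure on $Z$, and $z_1,z_2,\dots\in Z$ such that $\{z_k,\sigma(z_k)\}_{k\ge1}$ is an orthonormal basis of $Z$. Let $X=(\mathbb Z/2)^{\mathbb N}$ be the group of sequences $x=(x_1,x_2,\dots)$ of zeros and ones, with the $\sigma$-algebra generated by the sets $\{x_k=1\}$; let $\Delta\subset X$ be the subgroup of sequences with finitely many ones, and let $\delta_k\in\Delta$ have its only $1$ in the $k$-th place. Consider triples $(\mu,\nu,\{c_k\})$, where * $\mu$ is a $\sigma$-finite positive measure on $X$, quasi-invariant under $\Delta$: for $\delta\in\Delta$ the measures $\mu$ and $\mu_\delta(E)=\mu(E+\delta)$ have the same null sets; * $\nu:X\to\{0,1,2,\dots,\infty\}$ is measurable, and for all $\delta\in\Delta$, $\nu(x+\delta)=\nu(x)$ for almost all $x$. Put $H_x=H_{\nu(x)}$, where $H_n\subset\ell^2(\mathbb N,\mathbb C)$ is the span of the first $n$ standard basis vectors and $H_\infty=\ell^2(\mathbb N,\mathbb C)$; * $c_k(x)$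 ($k\ge1$) are unitary operators of $H_x$, depending measurably on $x$, such that for all $k,l$ and almost all $x$, $c_k(x)^*=c_k(x+\delta_k)$ and $c_k(x)c_l(x+\delta_k)=c_l(x)c_k(x+\delta_l)$. Let $H=\int_X^\oplus H_x\,d\mu(x)$, i.e. the Hilbert space of all $f\in L^2(X,\mu;\ell^2)$ with $f(x)\in H_x$ almost everywhere. The Gårding–Wightman (GW) module of the triple is the representation of $C(Z)$ on $H$ by bounded complex linear operators which extends the continuous real linear map $v\mapsto\mathbb J_v$, $v\in Z$, determined by $$(\mathbb J_{z_k}f)(x)=(-1)^{x_1+\dots+x_{k-1}+1}\,i\,c_k(x)\sqrt{\frac{d\mu_{\delta_k}}{d\mu}(x)}\;f(x+\delta_k),\qquad(\mathbb J_{\sigma(z_k)}f)(x)=(-1)^{x_k}\,i\,(\mathbb J_{z_k}f)(x).$$ It is irreducible over $\mathbb C$ (over $\mathbb R$) if $H\ne0$ and the only closed complex (real) subspaces of $H$ invariant under $C(Z)$ are $0$ and $H$. An invariant real form is a closed $C(Z)$-invariant real subspace $V\subset H$ on which the scalar product of $H$ is real and for which $H=V\oplus iV$. The measure $\mu$ is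 discrete if it is concentrated on a countable set. **Corollary 3.7.** If $\mu$ is discrete and the GW module of $(\mu,\nu,\{c_k\})$ is irreducible over $\mathbb C$, then it is irreducible over $\mathbb R$. In particular, the Fermi–Fock representation, i.e. the GW module of $(\mu,1,1)$ where $\mu$ is the counting measure on $\Delta$ (so that $\mu(\{\delta\})=1$ for all $\delta\in\Delta$ and $\mu(X\setminus\Delta)=0$), is irreducible over $\mathbb C$ and over $\mathbb R$, and has no invariant real form. -/

import Mathlib

open MeasureTheory
open scoped ENNReal

noncomputable section

namespace GW

/-- The group of sequences `x = (x₀, x₁, …)` of zeros and ones, under componentwise addition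
modulo `2`. The `σ`-algebra is the product one, i.e. the one generated by the sets
`{x | x k = 1}`. -/
abbrev X : Type := ℕ → ZMod 2

/-- The subgroup of the sequences with only finitely many ones. -/
def Delta : AddSubgroup X where
  carrier := {x | {k | x k ≠ 0}.Finite}
  zero_mem' := by simp
  add_mem' {x y} hx hy := by
    refine (Set.Finite.union hx hy).subset fun k hk => ?_
    by_contra h
    simp only [Set.mem_union, Set.mem_ofPred_eq, not_or, not_not] at h
    exact hk (by simp [h.1, h.2])
  neg_mem' {x} hx := by simpa using hx

/-- The sequence whose `k`-th entry is `1` and whose other entries are `0`. -/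
def delta (k : ℕ) : X := Pi.single k 1

lemma delta_mem (k : ℕ) : delta k ∈ Delta := by
  refine (Set.finite_singleton k).subset fun j hj => ?_
  by_contra h
  exact hj (Pi.single_eq_of_ne h _)

lemma add_self (x : X) : x + x = 0 := by
  ext k
  exact CharTwo.add_self_eq_zero (x k)

lemma add_add_self (x y : X) : x + y + y = x := by
  rw [add_assoc, add_self, add_zero]

/-- The translate `E ↦ μ (E + δ)` of a measure `μ` (recall `-δ = δ`). -/
def translate (μ : Measure X) (δ : X) : Measure X := μ.map (fun x => x + δ)

/-- The Hilbert space `ℓ²` in which all fibres are realized. -/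
abbrev L2 : Type := lp (fun _ : ℕ => ℂ) 2

/-- The model Hilbert space of dimension `n ∈ {0, 1, 2, …, ∞}`: the span of the first `n`
vectors of the standard basis of `ℓ²`, and all of `ℓ²` if `n = ∞`. -/
def fiber (n : ℕ∞) : Submodule ℂ L2 where
  carrier := {v | ∀ i : ℕ, n ≤ (i : ℕ∞) → v i = 0}
  zero_mem' := by intro i _; rfl
  add_mem' {v w} hv hw := by
    intro i hi
    have : (v + w) i = v i + w i := rfl
    rw [this, hv i hi, hw i hi, add_zero]
  smul_mem' c v hv := by
    intro i hi
    have : (c • v) i = c • v i := rfl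
    rw [this, hv i hi, smul_zero]

/-- `T` restricts to a unitary operator of the subspace `K` onto itself. -/
def IsUnitaryOn (T : L2 →L[ℂ] L2) (K : Submodule ℂ L2) : Prop :=
  Set.MapsTo T K K ∧ Set.SurjOn T K K ∧ ∀ v ∈ K, ‖T v‖ = ‖v‖

/-- The parameters `(μ, ν, {c_k})` of a Gårding–Wightman module. The Hilbert space `H_x` is
`fiber (ν x)`. -/
structure Triple where
  /-- the measure -/
  μ : Measure X
  sigmaFinite : SigmaFinite μ
  /-- quasi-invariance: the translates of `μ` by finite sequences have the null sets of `μ` -/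
  quasi_invariant : ∀ δ ∈ Delta, translate μ δ ≪ μ ∧ μ ≪ translate μ δ
  /-- the dimensions of the spaces `H_x` -/
  ν : X → ℕ∞
  measurable_ν : Measurable ν
  ν_add : ∀ δ ∈ Delta, ∀ᵐ x ∂μ, ν (x + δ) = ν x
  /-- the operators `c_k(x) : H_x → H_{x + δ_k} = H_x`; only the restriction of `c k x` to
  `fiber (ν x)` is relevant -/
  c : ℕ → X → L2 →L[ℂ] L2
  measurable_c : ∀ k v, AEStronglyMeasurable (fun x => c k x v) μ
  unitary_c : ∀ k, ∀ᵐ x ∂μ, IsUnitaryOn (c k x) (fiber (ν x))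
  /-- `c_k(x)^* = c_k(x + δ_k)` -/
  adjoint_c : ∀ k, ∀ᵐ x ∂μ, ∀ v ∈ fiber (ν x), ∀ w ∈ fiber (ν x),
    inner ℂ (c k x v) w = inner ℂ v (c k (x + delta k) w)
  /-- `c_k(x) c_l(x + δ_k) = c_l(x) c_k(x + δ_l)` -/
  comm_c : ∀ k l, ∀ᵐ x ∂μ, ∀ v ∈ fiber (ν x),
    c k x (c l (x + delta k) v) = c l x (c k (x + delta l) v)

attribute [instance] Triple.sigmaFinite

namespace Triple

variable (D : Triple)

/-- The direct integral `∫^⊕ H_x dμ(x)`: the (classes of) square integrable functions `f` with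
`f(x) ∈ H_x` for almost all `x`. -/
def directIntegral : Submodule ℂ (Lp L2 2 D.μ) where
  carrier := {f | ∀ᵐ x ∂D.μ, f x ∈ fiber (D.ν x)}
  zero_mem' := by
    filter_upwards [Lp.coeFn_zero L2 2 D.μ] with x hx
    rw [hx]
    exact zero_mem _
  add_mem' {f g} hf hg := by
    filter_upwards [hf, hg, Lp.coeFn_add f g] with x h1 h2 h3
    rw [h3]
    exact add_mem h1 h2
  smul_mem' a f hf := by
    filter_upwards [hf, Lp.coeFn_smul a f] with x h1 h3
    rw [h3]
    exact Submodule.smul_mem _ a h1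


lemma isClosed_fiber (n : ℕ∞) : IsClosed (fiber n : Set L2) := by
  have : (fiber n : Set L2) = ⋂ (i : ℕ) (_ : n ≤ (i : ℕ∞)), {v : L2 | v i = 0} := by
    ext v
    simp only [Set.mem_iInter]
    rfl
  rw [this]
  refine isClosed_iInter fun i => isClosed_iInter fun _ => ?_
  refine isClosed_eq ?_ continuous_const
  exact (lp.evalCLM ℂ (fun _ : ℕ => ℂ) 2 i).continuous

lemma isClosed_directIntegral : IsClosed (D.directIntegral : Set (Lp L2 2 D.μ)) := by
  refine IsSeqClosed.isClosed fun u f hu hf => ?_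
  obtain ⟨ns, -, hns⟩ := (tendstoInMeasure_of_tendsto_Lp hf).exists_seq_tendsto_ae
  have h : ∀ᵐ x ∂D.μ, ∀ n, u n x ∈ fiber (D.ν x) := ae_all_iff.2 hu
  change ∀ᵐ x ∂D.μ, f x ∈ fiber (D.ν x)
  filter_upwards [hns, h] with x h1 h2
  exact (isClosed_fiber _).mem_of_tendsto h1 (Filter.Eventually.of_forall fun n => h2 _)

/-- The complex Hilbert space of the module, with the structure inherited from `L²(X, μ; ℓ²)`. -/
def H : Type := D.directIntegral

instance : NormedAddCommGroup D.H := inferInstanceAs (NormedAddCommGroup D.directIntegral)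

instance : InnerProductSpace ℂ D.H := inferInstanceAs (InnerProductSpace ℂ D.directIntegral)

instance : CompleteSpace D.H := D.isClosed_directIntegral.completeSpace_coe

/-- The elements of `H` are (classes of) functions on `X`. -/
instance : CoeOut D.H (Lp L2 2 D.μ) := ⟨Subtype.val⟩

/-- The Radon–Nikodym derivative `dμ(x + δ) / dμ(x)`. -/
def density (δ : X) (x : X) : ℝ := ((translate D.μ δ).rnDeriv D.μ x).toReal


lemma measurable_add_right (δ : X) : Measurable fun x : X => x + δ :=
  measurable_id.add_const δ

/-- Translation by `δ` as a measurable equivalence. -/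
def shift (δ : X) : X ≃ᵐ X where
  toFun x := x + δ
  invFun x := x + δ
  left_inv x := add_add_self x δ
  right_inv x := add_add_self x δ
  measurable_toFun := measurable_add_right δ
  measurable_invFun := measurable_add_right δ

lemma translate_eq (δ : X) : translate D.μ δ = D.μ.map (shift δ) := rfl

instance (δ : X) : SigmaFinite (translate D.μ δ) := (shift δ).sigmaFinite_map

lemma quasiMeasurePreserving {δ : X} (hδ : δ ∈ Delta) :
    Measure.QuasiMeasurePreserving (fun x : X => x + δ) D.μ D.μ :=
  ⟨measurable_add_right δ, (D.quasi_invariant δ hδ).1⟩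

lemma ae_shift {δ : X} (hδ : δ ∈ Delta) {p : X → Prop} (h : ∀ᵐ x ∂D.μ, p x) :
    ∀ᵐ x ∂D.μ, p (x + δ) :=
  (D.quasiMeasurePreserving hδ).ae h

lemma lintegral_density {δ : X} (hδ : δ ∈ Delta) {g : X → ℝ≥0∞} (hg : AEMeasurable g D.μ) :
    ∫⁻ x, (translate D.μ δ).rnDeriv D.μ x * g (x + δ) ∂D.μ = ∫⁻ x, g x ∂D.μ := by
  have h1 : AEMeasurable (fun x => g (x + δ)) D.μ :=
    hg.comp_quasiMeasurePreserving (D.quasiMeasurePreserving hδ)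
  rw [lintegral_rnDeriv_mul (D.quasi_invariant δ hδ).1 h1, translate_eq, lintegral_map_equiv]
  simp only [shift, MeasurableEquiv.coe_mk, Equiv.coe_fn_mk, add_add_self]

lemma density_nonneg (δ x : X) : 0 ≤ D.density δ x := ENNReal.toReal_nonneg

lemma density_mul {δ ε : X} (hδ : δ ∈ Delta) (hε : ε ∈ Delta) :
    ∀ᵐ x ∂D.μ, D.density δ x * D.density ε (x + δ) = D.density (δ + ε) x := by
  have hmap : translate D.μ (δ + ε) = (translate D.μ ε).map (shift δ) := by
    unfold translate
    rw [Measure.map_map (shift δ).measurable (measurable_add_right ε)]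
    congr 1
    ext x : 1
    change x + (δ + ε) = x + ε + δ
    abel
  have h1 := (shift δ).measurableEmbedding.rnDeriv_map (translate D.μ ε) D.μ
  have hac : translate D.μ (δ + ε) ≪ translate D.μ δ := by
    rw [hmap, translate_eq]
    exact (D.quasi_invariant ε hε).1.map (shift δ).measurable
  have h2 := Measure.rnDeriv_mul_rnDeriv (κ := D.μ) hac
  have h3 := D.ae_shift hδ h1
  filter_upwards [h2, h3] with x h2 h3
  rw [← hmap, ← translate_eq] at h3
  have h4 : shift δ (x + δ) = x := add_add_self x δ
  rw [h4] at h3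
  rw [Pi.mul_apply, h3] at h2
  unfold density
  rw [← h2, ENNReal.toReal_mul, mul_comm]

lemma density_zero : ∀ᵐ x ∂D.μ, D.density 0 x = 1 := by
  have : translate D.μ 0 = D.μ := by
    unfold translate
    simp only [add_zero]
    exact Measure.map_id'
  filter_upwards [Measure.rnDeriv_self D.μ] with x hx
  rw [density, this, hx]
  simp

lemma c_c (k : ℕ) : ∀ᵐ x ∂D.μ, ∀ v ∈ fiber (D.ν x), D.c k x (D.c k (x + delta k) v) = v := by
  have key : ∀ᵐ x ∂D.μ, ∀ v ∈ fiber (D.ν x), D.c k (x + delta k) (D.c k x v) = v := by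
    filter_upwards [D.unitary_c k, D.ae_shift (delta_mem k) (D.unitary_c k),
      D.ν_add _ (delta_mem k), D.adjoint_c k] with x h1 h2 h3 h4 v hv
    rw [h3] at h2
    have h5 := h4 v hv (D.c k x v) (h1.1 hv)
    have h6 : ‖D.c k (x + delta k) (D.c k x v)‖ = ‖v‖ := by
      rw [h2.2.2 _ (h1.1 hv), h1.2.2 v hv]
    have h7 : ‖v - D.c k (x + delta k) (D.c k x v)‖ ^ 2 = 0 := by
      rw [@norm_sub_sq ℂ, ← h5, h6, inner_self_eq_norm_sq, h1.2.2 v hv]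
      ring
    exact (sub_eq_zero.1 (norm_eq_zero.1 (pow_eq_zero_iff two_ne_zero |>.1 h7))).symm
  filter_upwards [D.ae_shift (delta_mem k) key, D.ν_add _ (delta_mem k)] with x h1 h2 v hv
  rw [h2, add_add_self] at h1
  exact h1 v hv

lemma aestronglyMeasurable_c (k : ℕ) {f : X → L2} (hf : AEStronglyMeasurable f D.μ) :
    AEStronglyMeasurable (fun x => D.c k x (f x)) D.μ := by
  have hs : ∀ s : SimpleFunc X L2, AEStronglyMeasurable (fun x => D.c k x (s x)) D.μ := by
    intro s
    induction s using SimpleFunc.induction with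
    | const v hs =>
      refine ((D.measurable_c k v).indicator hs).congr (Filter.Eventually.of_forall fun x => ?_)
      classical
      simp only [Set.indicator, SimpleFunc.coe_piecewise, SimpleFunc.coe_const, Set.piecewise,
        Function.const_apply]
      split_ifs <;> simp
    | add _ hf hg =>
      refine (hf.add hg).congr (Filter.Eventually.of_forall fun x => ?_)
      simp only [Pi.add_apply, SimpleFunc.coe_add, map_add]
  have h1 : AEStronglyMeasurable (fun x => D.c k x (hf.mk f x)) D.μ := by
    refine aestronglyMeasurable_of_tendsto_ae Filter.atTop
      (fun n => hs (hf.stronglyMeasurable_mk.approx n)) (Filter.Eventually.of_forall fun x => ?_)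
    exact ((D.c k x).continuous.tendsto _).comp (hf.stronglyMeasurable_mk.tendsto_approx x)
  refine h1.congr ?_
  filter_upwards [hf.ae_eq_mk] with x hx
  rw [hx]

/-- The function `x ↦ s(x) c_k(x) √(dμ(x + δ_k) / dμ(x)) f(x + δ_k)`. -/
def weightFun (k : ℕ) (s : X → ℂ) (f : X → L2) (x : X) : L2 :=
  (s x * (Real.sqrt (D.density (delta k) x) : ℂ)) • D.c k x (f (x + delta k))

lemma weightFun_congr (k : ℕ) (s : X → ℂ) {f g : X → L2} (h : f =ᵐ[D.μ] g) :
    D.weightFun k s f =ᵐ[D.μ] D.weightFun k s g := by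
  filter_upwards [D.ae_shift (delta_mem k) h] with x hx
  rw [weightFun, weightFun, hx]

lemma weightFun_mem (k : ℕ) (s : X → ℂ) {f : X → L2} (h : ∀ᵐ x ∂D.μ, f x ∈ fiber (D.ν x)) :
    ∀ᵐ x ∂D.μ, D.weightFun k s f x ∈ fiber (D.ν x) := by
  filter_upwards [D.ae_shift (delta_mem k) h, D.ν_add _ (delta_mem k), D.unitary_c k]
    with x h1 h2 h3
  rw [h2] at h1
  exact Submodule.smul_mem _ _ (h3.1 h1)

lemma weightFun_aestronglyMeasurable (k : ℕ) {s : X → ℂ} (hs : Measurable s) {f : X → L2}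
    (hf : AEStronglyMeasurable f D.μ) : AEStronglyMeasurable (D.weightFun k s f) D.μ := by
  have h1 : Measurable fun x => s x * (Real.sqrt (D.density (delta k) x) : ℂ) :=
    hs.mul (Complex.measurable_ofReal.comp (Real.continuous_sqrt.measurable.comp
      (Measure.measurable_rnDeriv _ _).ennreal_toReal))
  exact h1.aestronglyMeasurable.smul (D.aestronglyMeasurable_c k
    (hf.comp_quasiMeasurePreserving (D.quasiMeasurePreserving (delta_mem k))))

lemma weightFun_eLpNorm (k : ℕ) {s : X → ℂ} (hs : ∀ x, ‖s x‖ = 1) {f : X → L2}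
    (hf : AEStronglyMeasurable f D.μ) (h : ∀ᵐ x ∂D.μ, f x ∈ fiber (D.ν x)) :
    eLpNorm (D.weightFun k s f) 2 D.μ = eLpNorm f 2 D.μ := by
  rw [eLpNorm_eq_lintegral_rpow_enorm_toReal two_ne_zero ENNReal.ofNat_ne_top,
    eLpNorm_eq_lintegral_rpow_enorm_toReal two_ne_zero ENNReal.ofNat_ne_top]
  congr 1
  have hg : AEMeasurable (fun x => ‖f x‖ₑ ^ (2 : ℝ≥0∞).toReal) D.μ := hf.enorm.pow_const _
  rw [← D.lintegral_density (delta_mem k) hg]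
  refine lintegral_congr_ae ?_
  filter_upwards [D.ae_shift (delta_mem k) h, D.ν_add _ (delta_mem k), D.unitary_c k,
    Measure.rnDeriv_lt_top (translate D.μ (delta k)) D.μ] with x h1 h2 h3 h4
  rw [h2] at h1
  have h5 : ‖D.c k x (f (x + delta k))‖ₑ = ‖f (x + delta k)‖ₑ := by
    rw [← ofReal_norm, ← ofReal_norm, h3.2.2 _ h1]
  rw [weightFun, enorm_smul, h5, ENNReal.mul_rpow_of_nonneg _ _ ENNReal.toReal_nonneg]
  congr 1
  rw [← ofReal_norm, norm_mul, hs, one_mul, Complex.norm_real, Real.norm_of_nonneg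
    (Real.sqrt_nonneg _), ENNReal.toReal_ofNat, ENNReal.ofReal_rpow_of_nonneg
    (Real.sqrt_nonneg _) zero_le_two, Real.rpow_two, Real.sq_sqrt (D.density_nonneg _ _), density,
    ENNReal.ofReal_toReal h4.ne]

lemma weightFun_memLp (k : ℕ) {s : X → ℂ} (hs : Measurable s) (hs1 : ∀ x, ‖s x‖ = 1) (f : D.H) :
    MemLp (D.weightFun k s (f : Lp L2 2 D.μ)) 2 D.μ :=
  ⟨D.weightFun_aestronglyMeasurable k hs (Lp.aestronglyMeasurable _),
    (D.weightFun_eLpNorm k hs1 (Lp.aestronglyMeasurable _) f.2).trans_lt (Lp.eLpNorm_lt_top _)⟩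

/-- The isometry `(W f)(x) = s(x) c_k(x) √(dμ(x + δ_k) / dμ(x)) f(x + δ_k)` of the direct
integral, where `|s| = 1`. -/
def weightOp (k : ℕ) (s : X → ℂ) (hs : Measurable s) (hs1 : ∀ x, ‖s x‖ = 1) :
    D.H →ₗᵢ[ℂ] D.H where
  toFun f := (Subtype.mk ((D.weightFun_memLp k hs hs1 f).toLp _) <| by
    filter_upwards [D.weightFun_mem k s f.2, (D.weightFun_memLp k hs hs1 f).coeFn_toLp]
      with x h1 h2
    rw [h2]
    exact h1 : D.directIntegral)
  map_add' f g := by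
    refine Subtype.ext ?_
    change (D.weightFun_memLp k hs hs1 (f + g)).toLp _ =
      (D.weightFun_memLp k hs hs1 f).toLp _ + (D.weightFun_memLp k hs hs1 g).toLp _
    rw [← MemLp.toLp_add, MemLp.toLp_eq_toLp_iff]
    refine (D.weightFun_congr k s (Lp.coeFn_add (f : Lp L2 2 D.μ) g)).trans ?_
    refine Filter.Eventually.of_forall fun x => ?_
    simp only [weightFun, Pi.add_apply, map_add, smul_add]
  map_smul' a f := by
    refine Subtype.ext ?_
    change (D.weightFun_memLp k hs hs1 (a • f)).toLp _ =
      a • (D.weightFun_memLp k hs hs1 f).toLp _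
    rw [← MemLp.toLp_const_smul, MemLp.toLp_eq_toLp_iff]
    refine (D.weightFun_congr k s (Lp.coeFn_smul a (f : Lp L2 2 D.μ))).trans ?_
    refine Filter.Eventually.of_forall fun x => ?_
    simp only [weightFun, Pi.smul_apply, map_smul]
    rw [smul_comm]
  norm_map' f := by
    change ‖(D.weightFun_memLp k hs hs1 f).toLp _‖ = ‖(f : Lp L2 2 D.μ)‖
    rw [Lp.norm_toLp, Lp.norm_def,
      D.weightFun_eLpNorm k hs1 (Lp.aestronglyMeasurable _) f.2]

lemma weightOp_apply (k : ℕ) (s : X → ℂ) (hs : Measurable s) (hs1 : ∀ x, ‖s x‖ = 1) (f : D.H) :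
    ((D.weightOp k s hs hs1 f : Lp L2 2 D.μ) : X → L2) =ᵐ[D.μ]
      D.weightFun k s (f : Lp L2 2 D.μ) :=
  (D.weightFun_memLp k hs hs1 f).coeFn_toLp

lemma weightOp_weightOp (k l : ℕ) (s t : X → ℂ) (hs : Measurable s) (hs1 : ∀ x, ‖s x‖ = 1)
    (ht : Measurable t) (ht1 : ∀ x, ‖t x‖ = 1) (f : D.H) :
    ∀ᵐ x ∂D.μ, (D.weightOp k s hs hs1 (D.weightOp l t ht ht1 f) : Lp L2 2 D.μ) x =
      (s x * t (x + delta k)) • ((Real.sqrt (D.density (delta k + delta l) x) : ℂ) •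
        D.c k x (D.c l (x + delta k) ((f : Lp L2 2 D.μ) (x + (delta k + delta l))))) := by
  filter_upwards [D.weightOp_apply k s hs hs1 (D.weightOp l t ht ht1 f),
    D.ae_shift (delta_mem k) (D.weightOp_apply l t ht ht1 f),
    D.density_mul (delta_mem k) (delta_mem l)] with x h1 h2 h3
  rw [h1, weightFun, h2, weightFun, ← h3, Real.sqrt_mul (D.density_nonneg _ _), map_smul,
    add_assoc, smul_smul, smul_smul]
  congr 1
  push_cast
  ring

/-! ### The phases and the generators -/

/-- The phase `(-1)^{x₀ + … + x_{k-1} + 1} i` of `J_{z_k}`. -/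
def phaseZ (k : ℕ) (x : X) : ℂ :=
  (-1) ^ ((∑ j ∈ Finset.range k, (x j).val) + 1) * Complex.I

/-- The phase of `J_{σ(z_k)}`, which is `(-1)^{x_k} i` times that of `J_{z_k}`. -/
def phaseSigma (k : ℕ) (x : X) : ℂ := (-1) ^ (x k).val * Complex.I * phaseZ k x

lemma measurable_comp_val {β : Type*} [MeasurableSpace β] (g : ZMod 2 → β) (j : ℕ) :
    Measurable fun x : X => g (x j) :=
  (measurable_of_countable g).comp (measurable_pi_apply j)

lemma measurable_phaseZ (k : ℕ) : Measurable (phaseZ k) := by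
  unfold phaseZ
  refine Measurable.mul_const ?_ _
  refine (measurable_of_countable fun n : ℕ => (-1 : ℂ) ^ (n + 1)).comp ?_
  exact Finset.measurable_sum _ fun j _ => measurable_comp_val ZMod.val j

lemma measurable_phaseSigma (k : ℕ) : Measurable (phaseSigma k) :=
  ((measurable_comp_val (fun a => (-1 : ℂ) ^ a.val) k).mul_const _).mul (measurable_phaseZ k)

lemma norm_phaseZ (k : ℕ) (x : X) : ‖phaseZ k x‖ = 1 := by simp [phaseZ]

lemma norm_phaseSigma (k : ℕ) (x : X) : ‖phaseSigma k x‖ = 1 := by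
  simp [phaseSigma, norm_phaseZ]

/-- The operator `J_{z_k}`:
`(J_{z_k} f)(x) = (-1)^{x₀ + … + x_{k-1} + 1} i c_k(x) √(dμ(x + δ_k) / dμ(x)) f(x + δ_k)`. -/
def JZ (k : ℕ) : D.H →ₗᵢ[ℂ] D.H :=
  D.weightOp k (phaseZ k) (measurable_phaseZ k) (norm_phaseZ k)

/-- The operator `J_{σ(z_k)}`: `(J_{σ(z_k)} f)(x) = (-1)^{x_k} i (J_{z_k} f)(x)`. -/
def JSigma (k : ℕ) : D.H →ₗᵢ[ℂ] D.H :=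
  D.weightOp k (phaseSigma k) (measurable_phaseSigma k) (norm_phaseSigma k)

/-- All generators: `J_{z_k}` has the index `inl k` and `J_{σ(z_k)}` the index `inr k`. -/
def gen : ℕ ⊕ ℕ → D.H →L[ℂ] D.H :=
  Sum.elim (fun k => (D.JZ k).toContinuousLinearMap) (fun k => (D.JSigma k).toContinuousLinearMap)

lemma sign_add_self (x : X) (k : ℕ) :
    (-1 : ℂ) ^ ((x + delta k) k).val = -(-1) ^ (x k).val := by
  have h : (x + delta k) k = x k + 1 := by simp [delta]
  rw [h]
  generalize x k = a
  fin_cases a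
  · change (-1 : ℂ) ^ 1 = -(-1) ^ 0
    norm_num
  · change (-1 : ℂ) ^ 0 = -(-1) ^ 1
    norm_num

lemma sign_add_of_ne (x : X) {j k : ℕ} (h : j ≠ k) :
    (-1 : ℂ) ^ ((x + delta k) j).val = (-1) ^ (x j).val := by
  have h : (x + delta k) j = x j := by simp [delta, h]
  rw [h]

lemma phaseZ_eq (k : ℕ) (x : X) :
    phaseZ k x = -(∏ j ∈ Finset.range k, (-1 : ℂ) ^ (x j).val) * Complex.I := by
  rw [phaseZ, pow_succ, Finset.prod_pow_eq_pow_sum]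
  ring

lemma phaseZ_add_of_le (x : X) {k l : ℕ} (h : k ≤ l) : phaseZ k (x + delta l) = phaseZ k x := by
  rw [phaseZ_eq, phaseZ_eq]
  congr 2
  refine Finset.prod_congr rfl fun j hj => sign_add_of_ne x ?_
  have := Finset.mem_range.1 hj
  omega

lemma phaseZ_add_of_lt (x : X) {k l : ℕ} (h : l < k) : phaseZ k (x + delta l) = -phaseZ k x := by
  rw [phaseZ_eq, phaseZ_eq]
  have hl : l ∈ Finset.range k := Finset.mem_range.2 h
  rw [← Finset.mul_prod_erase _ _ hl, ← Finset.mul_prod_erase _ _ hl, sign_add_self,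
    Finset.prod_congr rfl fun j hj => sign_add_of_ne x (Finset.ne_of_mem_erase hj)]
  ring

lemma phaseZ_sq (k : ℕ) (x : X) : phaseZ k x * phaseZ k x = -1 := by
  rw [phaseZ, mul_mul_mul_comm, Complex.I_mul_I, ← mul_pow]
  norm_num

lemma sign_sq (x : X) (k : ℕ) : (-1 : ℂ) ^ (x k).val * (-1) ^ (x k).val = 1 := by
  rw [← mul_pow]
  norm_num

/-- The position of a generator. -/
def pos : ℕ ⊕ ℕ → ℕ := Sum.elim id id

/-- The phase of a generator. -/
def phase : ℕ ⊕ ℕ → X → ℂ := Sum.elim phaseZ phaseSigma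

lemma phase_self (i : ℕ ⊕ ℕ) (x : X) : phase i x * phase i (x + delta (pos i)) = -1 := by
  rcases i with k | k
  · change phaseZ k x * phaseZ k (x + delta k) = -1
    rw [phaseZ_add_of_le x le_rfl, phaseZ_sq]
  · change phaseSigma k x * phaseSigma k (x + delta k) = -1
    rw [phaseSigma, phaseSigma, phaseZ_add_of_le x le_rfl, sign_add_self]
    linear_combination -(Complex.I * Complex.I) * (phaseZ k x * phaseZ k x) * sign_sq x k
      - (phaseZ k x * phaseZ k x) * Complex.I_mul_I + phaseZ_sq k x

lemma phase_add_of_lt (x : X) {i j : ℕ ⊕ ℕ} (h : pos i < pos j) :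
    phase i (x + delta (pos j)) = phase i x ∧ phase j (x + delta (pos i)) = -phase j x := by
  constructor
  · rcases i with k | k
    · exact phaseZ_add_of_le x h.le
    · change phaseSigma k _ = phaseSigma k x
      have h' : k ≠ pos j := ne_of_lt h
      have h2 := phaseZ_add_of_le x (k := k) (le_of_lt h)
      rw [phaseSigma, phaseSigma, h2, sign_add_of_ne x h']
  · rcases j with k | k
    · exact phaseZ_add_of_lt x h
    · change phaseSigma k _ = -phaseSigma k x
      have h' : k ≠ pos i := ne_of_gt h
      have h2 := phaseZ_add_of_lt x (k := k) h
      rw [phaseSigma, phaseSigma, h2, sign_add_of_ne x h']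
      ring

lemma phase_anticomm (x : X) {i j : ℕ ⊕ ℕ} (h : i ≠ j) :
    phase i x * phase j (x + delta (pos i)) = -(phase j x * phase i (x + delta (pos j))) := by
  rcases lt_trichotomy (pos i) (pos j) with hlt | heq | hlt
  · rw [(phase_add_of_lt x hlt).1, (phase_add_of_lt x hlt).2]
    ring
  · rcases i with k | k <;> rcases j with l | l
    · exact absurd (congrArg Sum.inl heq) h
    · obtain rfl : k = l := heq
      change phaseZ k x * phaseSigma k (x + delta k) = -(phaseSigma k x * phaseZ k (x + delta k))
      rw [phaseSigma, phaseSigma, phaseZ_add_of_le x le_rfl, sign_add_self]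
      ring
    · obtain rfl : k = l := heq
      change phaseSigma k x * phaseZ k (x + delta k) = -(phaseZ k x * phaseSigma k (x + delta k))
      rw [phaseSigma, phaseSigma, phaseZ_add_of_le x le_rfl, sign_add_self]
      ring
    · exact absurd (congrArg Sum.inr heq) h
  · rw [(phase_add_of_lt x hlt).1, (phase_add_of_lt x hlt).2]
    ring

lemma gen_gen (i j : ℕ ⊕ ℕ) (f : D.H) :
    ∀ᵐ x ∂D.μ, (D.gen i (D.gen j f) : Lp L2 2 D.μ) x =
      (phase i x * phase j (x + delta (pos i))) •
        ((Real.sqrt (D.density (delta (pos i) + delta (pos j)) x) : ℂ) •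
        D.c (pos i) x (D.c (pos j) (x + delta (pos i))
          ((f : Lp L2 2 D.μ) (x + (delta (pos i) + delta (pos j)))))) := by
  have h : ∀ i, ∃ (h1 : Measurable (phase i)) (h2 : ∀ x, ‖phase i x‖ = 1),
      D.gen i = (D.weightOp (pos i) (phase i) h1 h2).toContinuousLinearMap := by
    rintro (k | k)
    · exact ⟨measurable_phaseZ k, norm_phaseZ k, rfl⟩
    · exact ⟨measurable_phaseSigma k, norm_phaseSigma k, rfl⟩
  obtain ⟨i1, i2, hi⟩ := h i
  obtain ⟨j1, j2, hj⟩ := h j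
  rw [hi, hj]
  exact D.weightOp_weightOp _ _ _ _ i1 i2 j1 j2 f

lemma norm_gen (i : ℕ ⊕ ℕ) (f : D.H) : ‖D.gen i f‖ = ‖f‖ := by
  rcases i with k | k
  · exact (D.JZ k).norm_map f
  · exact (D.JSigma k).norm_map f

lemma gen_self (i : ℕ ⊕ ℕ) (f : D.H) : D.gen i (D.gen i f) = -f := by
  refine Subtype.ext (Lp.ext ?_)
  have h0 : ((-f : D.H) : Lp L2 2 D.μ) = -(f : Lp L2 2 D.μ) := rfl
  rw [h0]
  have hf : ∀ᵐ x ∂D.μ, (f : Lp L2 2 D.μ) x ∈ fiber (D.ν x) := f.2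
  filter_upwards [D.gen_gen i i f, Lp.coeFn_neg (f : Lp L2 2 D.μ), D.density_zero,
    D.c_c (pos i), hf] with x h1 h2 h3 h4 h5
  rw [h1, h2, add_self, add_zero, h3, h4 _ h5, phase_self]
  simp

lemma gen_anticomm {i j : ℕ ⊕ ℕ} (h : i ≠ j) (f : D.H) :
    D.gen i (D.gen j f) = -D.gen j (D.gen i f) := by
  refine Subtype.ext (Lp.ext ?_)
  have h0 : ((-D.gen j (D.gen i f) : D.H) : Lp L2 2 D.μ) =
    -(D.gen j (D.gen i f) : Lp L2 2 D.μ) := rfl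
  rw [h0]
  have hf : ∀ᵐ x ∂D.μ, (f : Lp L2 2 D.μ) x ∈ fiber (D.ν x) := f.2
  have hδ : delta (pos i) + delta (pos j) ∈ Delta := add_mem (delta_mem _) (delta_mem _)
  filter_upwards [D.gen_gen i j f, D.gen_gen j i f,
    Lp.coeFn_neg (D.gen j (D.gen i f) : Lp L2 2 D.μ), D.ae_shift hδ hf, D.ν_add _ hδ,
    D.comm_c (pos i) (pos j)] with x h1 h2 h3 h4 h5 h6
  rw [h5] at h4
  rw [h1, h3, Pi.neg_apply, h2, add_comm (delta (pos j)), h6 _ h4, phase_anticomm x h, neg_smul]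

lemma gen_skew (i : ℕ ⊕ ℕ) (f g : D.H) : inner ℂ (D.gen i f) g = -inner ℂ f (D.gen i g) := by
  have h : ∀ u v : D.H, inner ℂ (D.gen i u) (D.gen i v) = inner ℂ u v := by
    rcases i with k | k
    · exact (D.JZ k).inner_map_map
    · exact (D.JSigma k).inner_map_map
  rw [← h f (D.gen i g), gen_self, inner_neg_right, neg_neg]

/-! ### The action of the Clifford algebra -/

lemma gen_mul_self (i : ℕ ⊕ ℕ) : D.gen i * D.gen i = -1 :=
  ContinuousLinearMap.ext fun f => D.gen_self i f

lemma gen_mul_anticomm {i j : ℕ ⊕ ℕ} (h : i ≠ j) :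
    D.gen i * D.gen j + D.gen j * D.gen i = 0 := by
  refine ContinuousLinearMap.ext fun f => ?_
  change D.gen i (D.gen j f) + D.gen j (D.gen i f) = 0
  rw [D.gen_anticomm h, neg_add_cancel]

end Triple

section Quadratic

variable {Z : Type*} [NormedAddCommGroup Z] [InnerProductSpace ℝ Z]

/-- The quadratic form `v ↦ -(v, v)`, which makes the relations of the Clifford algebra
`v w + w v + 2 (v, w) = 0`. -/
def negNormSq (Z : Type*) [NormedAddCommGroup Z] [InnerProductSpace ℝ Z] : QuadraticForm ℝ Z :=
  -LinearMap.BilinMap.toQuadraticMap (innerₗ Z)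

lemma negNormSq_apply (v : Z) : negNormSq Z v = -inner ℝ v v := rfl

/-- The Clifford algebra `C(Z)`. -/
abbrev Cl (Z : Type*) [NormedAddCommGroup Z] [InnerProductSpace ℝ Z] : Type _ :=
  CliffordAlgebra (negNormSq Z)

end Quadratic

/-! ### Real linear combinations of anticommuting complex structures -/

section Generators

variable {H : Type*} [NormedAddCommGroup H] [InnerProductSpace ℂ H]

/-- A family of skew-hermitian, mutually anticommuting operators with square `-1`. -/
structure IsCliffordSystem {ι : Type*} (e : ι → H →L[ℂ] H) : Prop where
  mul_self : ∀ i, e i * e i = -1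
  anticomm : ∀ i j, i ≠ j → e i * e j + e j * e i = 0
  skew : ∀ i u v, inner ℂ (e i u) v = -inner ℂ u (e i v)

variable {ι : Type*} {e : ι → H →L[ℂ] H}

lemma IsCliffordSystem.sum_mul_self (he : IsCliffordSystem e) (a : ι → ℝ) (s : Finset ι) :
    (∑ i ∈ s, a i • e i) * (∑ i ∈ s, a i • e i) = (-∑ i ∈ s, a i * a i) • (1 : H →L[ℂ] H) := by
  classical
  induction s using Finset.induction_on with
  | empty => simp
  | insert j s hj ih =>
    rw [Finset.sum_insert hj, Finset.sum_insert hj, add_mul, mul_add, mul_add, ih]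
    have h1 : (a j • e j) * (a j • e j) = (-(a j * a j)) • (1 : H →L[ℂ] H) := by
      rw [smul_mul_smul_comm, he.mul_self, smul_neg, neg_smul]
    have h2 : (a j • e j) * (∑ i ∈ s, a i • e i) + (∑ i ∈ s, a i • e i) * (a j • e j) = 0 := by
      rw [Finset.mul_sum, Finset.sum_mul, ← Finset.sum_add_distrib]
      refine Finset.sum_eq_zero fun i hi => ?_
      have hji : j ≠ i := fun h => hj (h ▸ hi)
      rw [smul_mul_smul_comm, smul_mul_smul_comm, mul_comm (a i), ← smul_add,
        he.anticomm j i hji, smul_zero]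
    have h3 : ∀ p q r t : H →L[ℂ] H, q + r = 0 → p + q + (r + t) = p + t := by
      intro p q r t h
      rw [add_assoc, ← add_assoc q, h, zero_add]
    rw [h1, h3 _ _ _ _ h2, neg_add, add_smul]

lemma IsCliffordSystem.norm_sum_apply (he : IsCliffordSystem e) (a : ι → ℝ) (s : Finset ι)
    (f : H) : ‖(∑ i ∈ s, a i • e i) f‖ ^ 2 = (∑ i ∈ s, a i * a i) * ‖f‖ ^ 2 := by
  set T : H →L[ℂ] H := ∑ i ∈ s, a i • e i with hT
  have hskew : ∀ u v : H, inner ℂ (T u) v = -inner ℂ u (T v) := by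
    intro u v
    have happ : ∀ w : H, T w = ∑ i ∈ s, (a i : ℂ) • e i w := by
      intro w
      rw [hT, sum_apply]
      rfl
    rw [happ, happ, sum_inner, inner_sum, ← Finset.sum_neg_distrib]
    refine Finset.sum_congr rfl fun i _ => ?_
    rw [inner_smul_left, inner_smul_right, he.skew, Complex.conj_ofReal, mul_neg]
  have h1 : T (T f) = ((-∑ i ∈ s, a i * a i : ℝ) : ℂ) • f :=
    congrArg (fun S : H →L[ℂ] H => S f) (he.sum_mul_self a s)
  have h2 : inner ℂ (T f) (T f) = ((∑ i ∈ s, a i * a i : ℝ) : ℂ) * inner ℂ f f := by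
    rw [hskew, h1, inner_smul_right, Complex.ofReal_neg]
    ring
  rw [inner_self_eq_norm_sq_to_K, inner_self_eq_norm_sq_to_K] at h2
  apply Complex.ofReal_injective
  push_cast at h2 ⊢
  exact h2

lemma IsCliffordSystem.norm_sum_le (he : IsCliffordSystem e) (a : ι → ℝ) (s : Finset ι) :
    ‖∑ i ∈ s, a i • e i‖ ≤ Real.sqrt (∑ i ∈ s, a i * a i) := by
  refine ContinuousLinearMap.opNorm_le_bound _ (Real.sqrt_nonneg _) fun f => ?_
  rw [← Real.sqrt_sq (norm_nonneg ((∑ i ∈ s, a i • e i) f)), he.norm_sum_apply,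
    Real.sqrt_mul (Finset.sum_nonneg fun i _ => mul_self_nonneg _), Real.sqrt_sq (norm_nonneg f)]

lemma IsCliffordSystem.summable [CompleteSpace H] (he : IsCliffordSystem e) {a : ι → ℝ}
    (ha : Summable fun i => a i * a i) : Summable fun i => a i • e i := by
  rw [summable_iff_vanishing_norm]
  intro ε hε
  obtain ⟨s, hs⟩ := summable_iff_vanishing_norm.1 ha (ε ^ 2) (by positivity)
  refine ⟨s, fun t ht => (he.norm_sum_le a t).trans_lt ?_⟩
  rw [Real.sqrt_lt' hε]
  exact (le_abs_self _).trans_lt (hs t ht)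

lemma HilbertBasis_hasSum_sq {Z : Type*} [NormedAddCommGroup Z] [InnerProductSpace ℝ Z]
    (b : HilbertBasis ι ℝ Z) (v : Z) :
    HasSum (fun i => inner ℝ (b i) v * inner ℝ (b i) v) (inner ℝ v v) := by
  have h := b.hasSum_inner_mul_inner v v
  have h' : (fun i => inner ℝ v (b i) * inner ℝ (b i) v) =
      fun i => inner ℝ (b i) v * inner ℝ (b i) v := by
    funext i
    rw [real_inner_comm v]
  rwa [h'] at h

variable [CompleteSpace H] {Z : Type*} [NormedAddCommGroup Z] [InnerProductSpace ℝ Z]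

/-- The continuous real linear map `v ↦ J_v = ∑ᵢ (bᵢ, v) eᵢ` (the series converges in norm)
which takes the orthonormal basis `(bᵢ)` of `Z` to `(eᵢ)`. -/
def cliffordMap (he : IsCliffordSystem e) (b : HilbertBasis ι ℝ Z) : Z →ₗ[ℝ] (H →L[ℂ] H) where
  toFun v := ∑' i, (inner ℝ (b i) v : ℝ) • e i
  map_add' v w := by
    rw [← (he.summable (HilbertBasis_hasSum_sq b v).summable).tsum_add
      (he.summable (HilbertBasis_hasSum_sq b w).summable)]
    refine tsum_congr fun i => ?_
    rw [inner_add_right, add_smul]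
  map_smul' a v := by
    rw [RingHom.id_apply, ← (he.summable (HilbertBasis_hasSum_sq b v).summable).tsum_const_smul]
    refine tsum_congr fun i => ?_
    rw [real_inner_smul_right, mul_smul]

lemma cliffordMap_basis (he : IsCliffordSystem e) (b : HilbertBasis ι ℝ Z) (i : ι) :
    cliffordMap he b (b i) = e i := by
  change ∑' j, (inner ℝ (b j) (b i) : ℝ) • e j = e i
  rw [tsum_eq_single i]
  · rw [real_inner_self_eq_norm_sq, b.orthonormal.1 i, one_pow, one_smul]
  · intro j hj
    rw [b.orthonormal.2 hj, zero_smul]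

lemma cliffordMap_mul_self (he : IsCliffordSystem e) (b : HilbertBasis ι ℝ Z) (v : Z) :
    cliffordMap he b v * cliffordMap he b v =
      algebraMap ℝ (H →L[ℂ] H) (negNormSq Z v) := by
  have h1 : Filter.Tendsto (fun s : Finset ι => ∑ i ∈ s, (inner ℝ (b i) v : ℝ) • e i)
      Filter.atTop (nhds (cliffordMap he b v)) :=
    (he.summable (HilbertBasis_hasSum_sq b v).summable).hasSum
  have h3 : Filter.Tendsto (fun s : Finset ι => ∑ i ∈ s, inner ℝ (b i) v * inner ℝ (b i) v)
      Filter.atTop (nhds (inner ℝ v v)) := HilbertBasis_hasSum_sq b v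
  rw [Algebra.algebraMap_eq_smul_one, negNormSq_apply]
  refine tendsto_nhds_unique (h1.mul h1) ((h3.neg.smul_const (1 : H →L[ℂ] H)).congr fun s => ?_)
  rw [he.sum_mul_self]

end Generators

/-- A complex structure `σ` on the real Hilbert space `Z`, compatible with the metric, and a
unitary basis `z₀, z₁, …` of `(Z, σ)`, i.e. such that the `z_k` and `σ(z_k)` together form an
orthonormal (Hilbert) basis of the real space `Z`. Its existence means that `Z` is separable and
infinite dimensional. -/
structure UnitaryBasis (Z : Type*) [NormedAddCommGroup Z] [InnerProductSpace ℝ Z] where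
  /-- the complex structure -/
  σ : Z ≃ₗᵢ[ℝ] Z
  σ_σ : ∀ v, σ (σ v) = -v
  /-- the unitary basis -/
  z : ℕ → Z
  orthonormal : Orthonormal ℝ (Sum.elim z (fun k => σ (z k)))
  dense : ⊤ ≤ (Submodule.span ℝ (Set.range (Sum.elim z (fun k => σ (z k))))).topologicalClosure

section Clifford

variable {Z : Type*} [NormedAddCommGroup Z] [InnerProductSpace ℝ Z]
variable [CompleteSpace Z] (B : UnitaryBasis Z)

/-- The real orthonormal basis `{z_k, σ(z_k)}` of `Z`. -/
def UnitaryBasis.basis : HilbertBasis (ℕ ⊕ ℕ) ℝ Z := HilbertBasis.mk B.orthonormal B.dense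

lemma UnitaryBasis.basis_inl (k : ℕ) : B.basis (Sum.inl k) = B.z k := by
  simp [basis]

lemma UnitaryBasis.basis_inr (k : ℕ) : B.basis (Sum.inr k) = B.σ (B.z k) := by
  simp [basis]

namespace Triple

variable (D : Triple)

lemma isCliffordSystem_gen : IsCliffordSystem D.gen :=
  ⟨D.gen_mul_self, fun _ _ h => D.gen_mul_anticomm h, D.gen_skew⟩

/-- The operators `J_v`, `v ∈ Z`: the continuous real linear map which takes the prescribed values
`J_{z_k}` and `J_{σ(z_k)}` on the orthonormal basis `{z_k, σ(z_k)}`. -/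
def J : Z →ₗ[ℝ] (D.H →L[ℂ] D.H) := cliffordMap D.isCliffordSystem_gen B.basis

lemma J_z (k : ℕ) : D.J B (B.z k) = (D.JZ k).toContinuousLinearMap := by
  rw [← B.basis_inl, J, cliffordMap_basis]
  rfl

lemma J_σ_z (k : ℕ) : D.J B (B.σ (B.z k)) = (D.JSigma k).toContinuousLinearMap := by
  rw [← B.basis_inr, J, cliffordMap_basis]
  rfl

/-- The representation of the Clifford algebra `C(Z)` on the Hilbert space of the
Gårding–Wightman module. -/
def rep : Cl Z →ₐ[ℝ] (D.H →L[ℂ] D.H) :=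
  CliffordAlgebra.lift (negNormSq Z) ⟨D.J B, cliffordMap_mul_self D.isCliffordSystem_gen B.basis⟩

lemma rep_ι (v : Z) : D.rep B (CliffordAlgebra.ι (negNormSq Z) v) = D.J B v :=
  CliffordAlgebra.lift_ι_apply _ _ _

end Triple

end Clifford

/-! ### Irreducibility and invariant real forms -/

section Irreducible

variable {Z : Type*} [NormedAddCommGroup Z] [InnerProductSpace ℝ Z]
  {H : Type*} [NormedAddCommGroup H] [InnerProductSpace ℂ H]

/-- `U` is invariant under the action of `C(Z)`. For a complex subspace `U` this is the same as
invariance under `ℂ ⊗ C(Z)`. -/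
def IsInvariant (ρ : Cl Z →ₐ[ℝ] (H →L[ℂ] H)) (U : Set H) : Prop :=
  ∀ a : Cl Z, ∀ f ∈ U, ρ a f ∈ U

/-- Irreducibility over `ℂ`: `H ≠ 0`, and there is no closed invariant complex subspace other
than `0` and `H`. -/
def IsIrreducibleOverC (ρ : Cl Z →ₐ[ℝ] (H →L[ℂ] H)) : Prop :=
  Nontrivial H ∧ ∀ U : Submodule ℂ H, IsClosed (U : Set H) → IsInvariant ρ (U : Set H) →
    U = ⊥ ∨ U = ⊤

/-- Irreducibility over `ℝ`: `H ≠ 0`, and there is no closed invariant real subspace other than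
`0` and `H`. -/
def IsIrreducibleOverR (ρ : Cl Z →ₐ[ℝ] (H →L[ℂ] H)) : Prop :=
  Nontrivial H ∧ ∀ U : Submodule ℝ H, IsClosed (U : Set H) → IsInvariant ρ (U : Set H) →
    U = ⊥ ∨ U = ⊤

/-- `V` is an invariant real form of `H`: a closed invariant real subspace on which the scalar
product is real and such that `H = V ⊕ iV`. Equivalently, `V` is the set of fixed points of a norm
preserving antilinear involution `S` (namely `S (u + i v) = u - i v`) that commutes with `C(Z)`. -/
structure IsInvariantRealForm (ρ : Cl Z →ₐ[ℝ] (H →L[ℂ] H)) (V : Submodule ℝ H) : Prop where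
  isClosed : IsClosed (V : Set H)
  invariant : IsInvariant ρ (V : Set H)
  inner_real : ∀ u ∈ V, ∀ v ∈ V, (inner ℂ u v).im = 0
  decomposition : ∀ f : H, ∃! p : H × H, p.1 ∈ V ∧ p.2 ∈ V ∧ f = p.1 + Complex.I • p.2

end Irreducible

/-- A discrete measure: one that is concentrated on a countable set. -/
def IsDiscrete (μ : Measure X) : Prop := ∃ C : Set X, C.Countable ∧ μ Cᶜ = 0

/-! ### The Fermi–Fock representation -/

instance : Countable Delta := by
  refine Function.Injective.countable (f := fun x : Delta => Set.Finite.toFinset x.2) ?_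
  intro x y h
  have h' : ∀ k, (x : X) k ≠ 0 ↔ (y : X) k ≠ 0 := by
    intro k
    exact (Set.Finite.mem_toFinset x.2).symm.trans
      ((Finset.ext_iff.1 h k).trans (Set.Finite.mem_toFinset y.2))
  have key : ∀ a b : ZMod 2, (a ≠ 0 ↔ b ≠ 0) → a = b := by decide
  exact Subtype.ext (funext fun k => key _ _ (h' k))

/-- The counting measure of `Δ`, as a measure on `X`: the points of `Δ` have mass `1`, and the
complement of `Δ` has mass `0`. -/
def fockMeasure : Measure X := (Measure.count : Measure Delta).map Subtype.val

lemma measurableEmbedding_Delta : MeasurableEmbedding (Subtype.val : Delta → X) :=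
  MeasurableEmbedding.subtype_coe (Set.countable_coe_iff.1 (inferInstanceAs (Countable Delta))).measurableSet

instance : SigmaFinite fockMeasure := measurableEmbedding_Delta.sigmaFinite_map

lemma fockMeasure_eq_zero_iff (E : Set X) : fockMeasure E = 0 ↔ ∀ δ ∈ Delta, δ ∉ E := by
  rw [fockMeasure, measurableEmbedding_Delta.map_apply, Measure.count_eq_zero_iff]
  simp [Set.eq_empty_iff_forall_notMem]

lemma translate_fockMeasure_eq_zero_iff {δ : X} (hδ : δ ∈ Delta) (E : Set X) :
    translate fockMeasure δ E = 0 ↔ fockMeasure E = 0 := by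
  change fockMeasure.map (Triple.shift δ) E = 0 ↔ _
  rw [(Triple.shift δ).map_apply, fockMeasure_eq_zero_iff, fockMeasure_eq_zero_iff]
  constructor
  · intro h ε hε hE
    refine h (ε + δ) (add_mem hε hδ) ?_
    change ε + δ + δ ∈ E
    rwa [add_add_self]
  · intro h ε hε hE
    exact h (ε + δ) (add_mem hε hδ) hE

/-- The triple `(μ, 1, 1)` of the Fermi–Fock representation. -/
def fermiFock : Triple where
  μ := fockMeasure
  sigmaFinite := inferInstance
  quasi_invariant _ hδ :=
    ⟨fun E hE => (translate_fockMeasure_eq_zero_iff hδ E).2 hE,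
      fun E hE => (translate_fockMeasure_eq_zero_iff hδ E).1 hE⟩
  ν _ := 1
  measurable_ν := measurable_const
  ν_add _ _ := Filter.Eventually.of_forall fun _ => rfl
  c _ _ := ContinuousLinearMap.id ℂ L2
  measurable_c _ _ := aestronglyMeasurable_const
  unitary_c _ := Filter.Eventually.of_forall fun _ =>
    ⟨fun _ hv => hv, fun _ hv => ⟨_, hv, rfl⟩, fun _ _ => rfl⟩
  adjoint_c _ := Filter.Eventually.of_forall fun _ _ _ _ _ => rfl
  comm_c _ _ := Filter.Eventually.of_forall fun _ _ _ => rfl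

end GW

/-!
The operator `J_{z_k} J_{σ(z_k)}` is multiplication by `(-1)^{x_k} i`.

The functions supported on a given `Δ`-invariant set form an invariant subspace, so a module that is
irreducible over `ℂ` lives, when `μ` is discrete, on a single orbit `Δ + a`. Each point `x` of this
orbit satisfies `x_k = a_k` for large `k`, so the real operators `(-1)^{a_k} J_{z_k} J_{σ(z_k)}`
converge strongly to multiplication by `i`. Hence closed invariant real subspaces are complex.

Since the coordinates `x_k` generate the `σ`-algebra of `X`, an invariant complex subspace and its
orthogonal complement are orthogonal in almost every fibre. For the Fermi–Fock representation the
fibres are lines over the single orbit `Δ`, and the operators `J_{z_k}` permute them transitively,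
so one of the two subspaces is `0`. A module that is irreducible over `ℝ` has no invariant real form
because such a form is neither `0` nor the whole module.
-/

noncomputable section

namespace GW

open Filter Topology

section Lp

variable {α E : Type*} {m : MeasurableSpace α} {μ : Measure α} [NormedAddCommGroup E] {p : ℝ≥0∞}
  [Fact (1 ≤ p)]

lemma isClosed_setOf_ae_mem {s : α → Set E} (hs : ∀ x, IsClosed (s x)) :
    IsClosed {f : Lp E p μ | ∀ᵐ x ∂μ, f x ∈ s x} := by
  refine IsSeqClosed.isClosed fun u f hu hf => ?_
  obtain ⟨n, -, hn⟩ := (tendstoInMeasure_of_tendsto_Lp hf).exists_seq_tendsto_ae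
  filter_upwards [hn, ae_all_iff.2 hu] with x hx hxs
  exact (hs x).mem_of_tendsto hx (Eventually.of_forall fun _ => hxs _)

lemma tendsto_Lp_of_dominated (hp : p ≠ ∞) {F : ℕ → Lp E p μ} {f : Lp E p μ} {b : α → ℝ}
    (hb : MemLp b p μ) (hF : ∀ n, ∀ᵐ x ∂μ, ‖F n x‖ ≤ b x)
    (hlim : ∀ᵐ x ∂μ, Tendsto (fun n => F n x) atTop (𝓝 (f x))) :
    Tendsto F atTop (𝓝 f) := by
  have hp0 : p ≠ 0 := (zero_lt_one.trans_le Fact.out).ne'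
  have hp' : 0 < p.toReal := ENNReal.toReal_pos hp0 hp
  have hdom : ∀ n, ∀ᵐ x ∂μ, ‖(F n - f : α → E) x‖ₑ ^ p.toReal ≤ ‖(2 : ℝ) • b x‖ₑ ^ p.toReal := by
    intro n
    filter_upwards [ae_all_iff.2 hF, hlim] with x hFx hx
    refine ENNReal.rpow_le_rpow (enorm_le_iff_norm_le.2 ?_) hp'.le
    have hfx : ‖f x‖ ≤ b x := le_of_tendsto' hx.norm hFx
    calc ‖F n x - f x‖ ≤ b x + b x := (norm_sub_le _ _).trans (add_le_add (hFx n) hfx)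
      _ = (2 : ℝ) • b x := by rw [smul_eq_mul, two_mul]
      _ ≤ ‖(2 : ℝ) • b x‖ := Real.le_norm_self _
  have hpow : Tendsto (fun n => ∫⁻ x, ‖(F n - f : α → E) x‖ₑ ^ p.toReal ∂μ) atTop (𝓝 0) := by
    rw [← lintegral_zero (μ := μ)]
    refine tendsto_lintegral_of_dominated_convergence' _
      (fun n => ((Lp.aestronglyMeasurable _).sub (Lp.aestronglyMeasurable _)).enorm.pow_const _)
      hdom (lintegral_rpow_enorm_lt_top_of_eLpNorm_lt_top hp0 hp (hb.const_smul (2 : ℝ)).2).ne ?_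
    filter_upwards [hlim] with x hx
    have h := ((hx.sub_const (f x)).enorm).ennrpow_const p.toReal
    rwa [sub_self, enorm_zero, ENNReal.zero_rpow_of_pos hp'] at h
  rw [Lp.tendsto_Lp_iff_tendsto_eLpNorm']
  simp_rw [eLpNorm_eq_lintegral_rpow_enorm_toReal hp0 hp]
  have h := hpow.ennrpow_const (1 / p.toReal)
  rwa [ENNReal.zero_rpow_of_pos (one_div_pos.2 hp')] at h

end Lp

lemma ae_eq_zero_of_forall_setIntegral_pi_eq_zero {ι : Type*} {β : ι → Type*}
    [∀ i, MeasurableSpace (β i)] {μ : Measure (∀ i, β i)} {E : Type*} [NormedAddCommGroup E]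
    [NormedSpace ℝ E] [CompleteSpace E] {f : (∀ i, β i) → E} (hf : Integrable f μ)
    (h : ∀ (s : Finset ι) (t : ∀ i, Set (β i)), (∀ i, MeasurableSet (t i)) →
      ∫ x in (s : Set ι).pi t, f x ∂μ = 0) :
    f =ᵐ[μ] 0 := by
  have huniv : ∫ x, f x ∂μ = 0 := by simpa using h ∅ (fun _ => Set.univ) fun _ => .univ
  have hint : ∀ A, MeasurableSet A → ∫ x in A, f x ∂μ = 0 := by
    intro A hA
    induction A, hA using MeasurableSpace.induction_on_inter generateFrom_squareCylinders.symm
      (isPiSystem_squareCylinders (fun _ => MeasurableSpace.isPiSystem_measurableSet)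
        fun _ => MeasurableSet.univ) with
    | empty => rw [setIntegral_empty]
    | basic A hA =>
      obtain ⟨s, t, ht, rfl⟩ := hA
      exact h s t fun i => ht i (Set.mem_univ i)
    | compl A hA ih => rw [setIntegral_compl hA hf, huniv, ih, sub_zero]
    | iUnion A hd hA ih => simp only [integral_iUnion hA hd hf.integrableOn, ih, tsum_zero]
  exact hf.ae_eq_zero_of_forall_setIntegral_eq_zero fun A hA _ => hint A hA

lemma IsDiscrete.ae_iff {μ : Measure X} (hμ : IsDiscrete μ) {p : X → Prop} :
    (∀ᵐ x ∂μ, p x) ↔ ∀ x, μ {x} ≠ 0 → p x := by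
  obtain ⟨C, hC, hC0⟩ := hμ
  refine ⟨fun h x hx => ?_, fun h => ?_⟩
  · by_contra hpx
    exact hx (measure_mono_null (Set.singleton_subset_iff.2 hpx) h)
  · have hnull : μ {x ∈ C | ¬p x} = 0 :=
      (measure_null_iff_singleton (hC.mono (Set.sep_subset _ _))).2 fun x hx =>
        not_not.1 (mt (h x) hx.2)
    filter_upwards [measure_eq_zero_iff_ae_notMem.1 hnull, measure_eq_zero_iff_ae_notMem.1 hC0]
      with x hx hxC
    exact not_not.1 fun hpx => hx ⟨not_not.1 hxC, hpx⟩

lemma closure_range_delta : AddSubgroup.closure (Set.range delta) = Delta := by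
  refine le_antisymm ((AddSubgroup.closure_le _).2 (Set.range_subset_iff.2 delta_mem)) ?_
  intro d (hd : {k | d k ≠ 0}.Finite)
  have hone : ∀ c : ZMod 2, c ≠ 0 → c = 1 := by decide
  have hsum : d = ∑ k ∈ hd.toFinset, delta k := by
    ext j
    simp only [delta, Finset.sum_apply, Pi.single_apply, Finset.sum_ite_eq,
      Set.Finite.mem_toFinset, Set.mem_ofPred_eq]
    split_ifs with hj
    exacts [hone _ hj, not_not.1 hj]
  rw [hsum]
  exact sum_mem fun k _ => AddSubgroup.subset_closure (Set.mem_range_self k)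

lemma add_mem_of_forall_add_delta_mem {S : Set X} (hS : ∀ x ∈ S, ∀ k, x + delta k ∈ S) {d : X}
    (hd : d ∈ Delta) : ∀ x ∈ S, x + d ∈ S := by
  rw [← closure_range_delta] at hd
  induction hd using AddSubgroup.closure_induction with
  | mem d hd =>
    obtain ⟨k, rfl⟩ := hd
    exact fun x hx => hS x hx k
  | zero => simp only [add_zero, imp_self, implies_true]
  | add d e _ _ hd he => exact fun x hx => add_assoc x d e ▸ he _ (hd x hx)
  | neg d _ hd => rwa [neg_eq_of_add_eq_zero_left (add_self d)]

/-- The orbit `Δ + a` of `a` under the finite sequences. Since `-a = a`, membership of `x` is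
expressed by `x + a ∈ Δ`. -/
def coset (a : X) : Set X := {x | x + a ∈ Delta}

lemma mem_coset_self (a : X) : a ∈ coset a := by
  change a + a ∈ Delta
  rw [add_self]
  exact zero_mem _

lemma add_mem_coset_iff {a x d : X} (hd : d ∈ Delta) : x + d ∈ coset a ↔ x ∈ coset a := by
  change x + d + a ∈ Delta ↔ x + a ∈ Delta
  rw [add_right_comm, add_mem_cancel_right hd]

lemma countable_coset (a : X) : (coset a).Countable :=
  (Set.countable_coe_iff.1 (inferInstanceAs (Countable Delta))).preimage (add_left_injective a)

lemma isDiscrete_of_ae_mem_coset {μ : Measure X} {a : X} (ha : ∀ᵐ x ∂μ, x ∈ coset a) :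
    IsDiscrete μ :=
  ⟨coset a, countable_coset a, ha⟩

lemma eventually_eq_of_mem_coset {a x : X} (hx : x ∈ coset a) : ∀ᶠ k in atTop, x k = a k := by
  have hfin : {k | (x + a) k ≠ 0}.Finite := hx
  rw [← Nat.cofinite_eq_atTop]
  filter_upwards [hfin.compl_mem_cofinite] with k hk
  exact CharTwo.add_eq_zero.1 (not_not.1 hk)

section Representation

variable {Z : Type*} [NormedAddCommGroup Z] [InnerProductSpace ℝ Z]
  {H : Type*} [NormedAddCommGroup H] [InnerProductSpace ℂ H] {ρ : Cl Z →ₐ[ℝ] (H →L[ℂ] H)}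

lemma isInvariant_of_forall_ι_mem {U : Submodule ℝ H}
    (hU : ∀ v, ∀ f ∈ U, ρ (CliffordAlgebra.ι (negNormSq Z) v) f ∈ U) :
    IsInvariant ρ (U : Set H) := by
  intro a
  induction a using CliffordAlgebra.induction with
  | algebraMap r =>
    intro f hf
    rw [AlgHom.commutes, Algebra.algebraMap_eq_smul_one]
    exact U.smul_mem r hf
  | ι v => exact hU v
  | mul a b ha hb => exact fun f hf => map_mul ρ a b ▸ ha _ (hb f hf)
  | add a b ha hb => exact fun f hf => map_add ρ a b ▸ U.add_mem (ha f hf) (hb f hf)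

lemma cliffordMap_apply_mem [CompleteSpace H] {ι : Type*} {e : ι → H →L[ℂ] H}
    (he : IsCliffordSystem e) (b : HilbertBasis ι ℝ Z) {U : Submodule ℝ H}
    (hU : IsClosed (U : Set H)) {f : H} (hf : ∀ i, e i f ∈ U) (v : Z) :
    cliffordMap he b v f ∈ U := by
  have hsum : HasSum (fun i => (inner ℝ (b i) v : ℝ) • e i f) (cliffordMap he b v f) :=
    (he.summable (HilbertBasis_hasSum_sq b v).summable).hasSum.mapL
      (ContinuousLinearMap.apply ℂ H f)
  exact hU.mem_of_tendsto hsum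
    (Eventually.of_forall fun _ => U.sum_mem fun i _ => U.smul_mem _ (hf i))

lemma IsIrreducibleOverC.isIrreducibleOverR (h : IsIrreducibleOverC ρ)
    (hI : ∀ U : Submodule ℝ H, IsClosed (U : Set H) → IsInvariant ρ (U : Set H) →
      ∀ f ∈ U, Complex.I • f ∈ U) :
    IsIrreducibleOverR ρ := by
  refine ⟨h.1, fun U hc hU => ?_⟩
  have hsmul : ∀ (z : ℂ), ∀ f ∈ U, z • f ∈ U := by
    intro z f hf
    rw [← Complex.re_add_im z, add_smul, mul_smul, Complex.coe_smul, Complex.coe_smul]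
    exact U.add_mem (U.smul_mem _ hf) (U.smul_mem _ (hI U hc hU f hf))
  let W : Submodule ℂ H := { U.toAddSubmonoid with smul_mem' := fun z f hf => hsmul z f hf }
  have hW : W.restrictScalars ℝ = U := SetLike.coe_injective rfl
  rw [← hW, Submodule.restrictScalars_eq_bot_iff, Submodule.restrictScalars_eq_top_iff]
  exact h.2 W hc hU

lemma IsIrreducibleOverR.not_isInvariantRealForm (h : IsIrreducibleOverR ρ) (V : Submodule ℝ H) :
    ¬IsInvariantRealForm ρ V := by
  intro hV
  obtain ⟨f, hf⟩ := @exists_ne _ h.1 (0 : H)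
  rcases h.2 V hV.isClosed hV.invariant with rfl | rfl
  · obtain ⟨p, ⟨hp₁, hp₂, hfp⟩, -⟩ := hV.decomposition f
    rw [(Submodule.mem_bot ℝ).1 hp₁, (Submodule.mem_bot ℝ).1 hp₂, smul_zero, add_zero] at hfp
    exact hf hfp
  · have hre := hV.inner_real f trivial (Complex.I • f) trivial
    rw [inner_smul_right, Complex.I_mul_im] at hre
    exact hf (inner_self_eq_zero.1 (Complex.ext hre (inner_self_im (𝕜 := ℂ) f)))

end Representation

lemma eq_zero_of_mem_fiber_one {v w : L2} (hv : v ∈ fiber 1) (hw : w ∈ fiber 1) (hv0 : v ≠ 0)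
    (h : inner ℂ v w = 0) : w = 0 := by
  have hne : ∀ i : ℕ, i ≠ 0 → (1 : ℕ∞) ≤ i := fun i hi =>
    Order.one_le_iff_ne_zero.2 (Nat.cast_ne_zero.2 hi)
  have hv₀ : v 0 ≠ 0 := fun h0 => hv0 (lp.ext (funext fun i => by
    by_cases hi : i = 0
    exacts [hi ▸ h0, hv i (hne i hi)]))
  rw [lp.inner_eq_tsum, tsum_eq_single 0 fun i hi => by rw [hv i (hne i hi), inner_zero_left],
    RCLike.inner_apply, mul_eq_zero, map_eq_zero, or_iff_left hv₀] at h
  refine lp.ext (funext fun i => ?_)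
  by_cases hi : i = 0
  exacts [hi ▸ h, hw i (hne i hi)]

namespace Triple

variable {Z : Type*} [NormedAddCommGroup Z] [InnerProductSpace ℝ Z] [CompleteSpace Z]
  (B : UnitaryBasis Z) (D : Triple)

lemma gen_mem_of_isInvariant {U : Set D.H} (hU : IsInvariant (D.rep B) U) (i : ℕ ⊕ ℕ) {f : D.H}
    (hf : f ∈ U) : D.gen i f ∈ U := by
  have h := hU (CliffordAlgebra.ι (negNormSq Z) (B.basis i)) f hf
  rwa [rep_ι, J, cliffordMap_basis] at h

lemma isInvariant_of_gen_mem {U : Submodule ℝ D.H} (hc : IsClosed (U : Set D.H))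
    (hU : ∀ i, ∀ f ∈ U, D.gen i f ∈ U) : IsInvariant (D.rep B) (U : Set D.H) :=
  isInvariant_of_forall_ι_mem fun v f hf => by
    rw [rep_ι]
    exact cliffordMap_apply_mem D.isCliffordSystem_gen B.basis hc (fun i => hU i f hf) v

variable {D}

lemma ext_ae {f g : D.H} (h : (f : Lp L2 2 D.μ) =ᵐ[D.μ] (g : Lp L2 2 D.μ)) : f = g :=
  Subtype.ext (Lp.ext h)

lemma coeFn_zero : ((0 : D.H) : Lp L2 2 D.μ) =ᵐ[D.μ] fun _ => 0 :=
  Lp.coeFn_zero L2 2 D.μ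

lemma coeFn_add (f g : D.H) : ((f + g : D.H) : Lp L2 2 D.μ) =ᵐ[D.μ]
    fun x => (f : Lp L2 2 D.μ) x + (g : Lp L2 2 D.μ) x :=
  Lp.coeFn_add (f : Lp L2 2 D.μ) g

lemma coeFn_smul (a : ℂ) (f : D.H) : ((a • f : D.H) : Lp L2 2 D.μ) =ᵐ[D.μ]
    fun x => a • (f : Lp L2 2 D.μ) x :=
  Lp.coeFn_smul a (f : Lp L2 2 D.μ)

lemma ae_mem_fiber (f : D.H) : ∀ᵐ x ∂D.μ, (f : Lp L2 2 D.μ) x ∈ fiber (D.ν x) := f.2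

lemma exists_ae_eq_of_memLp {f : X → L2} (hf : MemLp f 2 D.μ)
    (hfib : ∀ᵐ x ∂D.μ, f x ∈ fiber (D.ν x)) : ∃ g : D.H, (g : Lp L2 2 D.μ) =ᵐ[D.μ] f := by
  have hmem : hf.toLp f ∈ D.directIntegral := by
    filter_upwards [hf.coeFn_toLp, hfib] with x hx hfx
    rwa [hx]
  exact ⟨(⟨_, hmem⟩ : D.directIntegral), hf.coeFn_toLp⟩

lemma tendsto_of_dominated {F : ℕ → D.H} {f g : D.H}
    (hF : ∀ n, ∀ᵐ x ∂D.μ, ‖(F n : Lp L2 2 D.μ) x‖ ≤ ‖(f : Lp L2 2 D.μ) x‖)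
    (hlim : ∀ᵐ x ∂D.μ, Tendsto (fun n => (F n : Lp L2 2 D.μ) x) atTop
      (𝓝 ((g : Lp L2 2 D.μ) x))) :
    Tendsto F atTop (𝓝 g) := by
  have hind : IsInducing (fun f : D.H => (f : Lp L2 2 D.μ)) := IsInducing.subtypeVal
  exact hind.tendsto_nhds_iff.2
    (tendsto_Lp_of_dominated ENNReal.ofNat_ne_top (Lp.memLp (f : Lp L2 2 D.μ)).norm hF hlim)

lemma inner_eq_integral (f g : D.H) :
    inner ℂ f g = ∫ x, inner ℂ ((f : Lp L2 2 D.μ) x) ((g : Lp L2 2 D.μ) x) ∂D.μ :=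
  L2.inner_def (f : Lp L2 2 D.μ) g

lemma gen_apply (i : ℕ ⊕ ℕ) (f : D.H) :
    (D.gen i f : Lp L2 2 D.μ) =ᵐ[D.μ] D.weightFun (pos i) (phase i) (f : Lp L2 2 D.μ) := by
  rcases i with k | k
  · exact D.weightOp_apply k _ (measurable_phaseZ k) (norm_phaseZ k) f
  · exact D.weightOp_apply k _ (measurable_phaseSigma k) (norm_phaseSigma k) f

lemma gen_apply_eq_zero_iff (i : ℕ ⊕ ℕ) (f : D.H) : ∀ᵐ x ∂D.μ,
    (D.gen i f : Lp L2 2 D.μ) x = 0 ↔ (f : Lp L2 2 D.μ) (x + delta (pos i)) = 0 := by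
  have hgen : ∀ g : D.H, ∀ᵐ x ∂D.μ, (g : Lp L2 2 D.μ) (x + delta (pos i)) = 0 →
      (D.gen i g : Lp L2 2 D.μ) x = 0 := fun g => by
    filter_upwards [gen_apply i g] with x hx hg
    rw [hx, weightFun, hg, map_zero, smul_zero]
  have hneg : ((-f : D.H) : Lp L2 2 D.μ) =ᵐ[D.μ] -(f : Lp L2 2 D.μ) :=
    Lp.coeFn_neg (f : Lp L2 2 D.μ)
  filter_upwards [hgen f, D.ae_shift (delta_mem (pos i)) (hgen (D.gen i f)),
    D.ae_shift (delta_mem (pos i)) hneg] with x hx hx' hnx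
  rw [add_add_self, gen_self, hnx, Pi.neg_apply, neg_eq_zero] at hx'
  exact ⟨hx', hx⟩

/-- The operator `J_{z_k} J_{σ(z_k)}`, which multiplies `f(x)` by `(-1)^{x_k} i`. -/
def parityOp (k : ℕ) : D.H →L[ℂ] D.H := D.gen (Sum.inl k) * D.gen (Sum.inr k)

lemma parityOp_apply (k : ℕ) (f : D.H) : (parityOp k f : Lp L2 2 D.μ) =ᵐ[D.μ]
    fun x => ((-1) ^ (x k).val * Complex.I) • (f : Lp L2 2 D.μ) x := by
  filter_upwards [D.gen_gen (Sum.inl k) (Sum.inr k) f, D.density_zero, D.c_c k, ae_mem_fiber f]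
    with x hgen hdensity hc hfx
  have hphase : phaseZ k x * phaseSigma k (x + delta k) = (-1) ^ (x k).val * Complex.I := by
    rw [phaseSigma, sign_add_self, phaseZ_add_of_le x le_rfl]
    linear_combination -((-1) ^ (x k).val * Complex.I) * phaseZ_sq k x
  simp only [pos, phase, Sum.elim_inl, Sum.elim_inr, id_eq, add_self, add_zero, hdensity, hc _ hfx,
    Real.sqrt_one, Complex.ofReal_one, one_smul, hphase] at hgen
  exact hgen

lemma parityOp_mem {U : Set D.H} (hU : IsInvariant (D.rep B) U) (k : ℕ) {f : D.H} (hf : f ∈ U) :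
    parityOp k f ∈ U :=
  D.gen_mem_of_isInvariant B hU (Sum.inl k) (D.gen_mem_of_isInvariant B hU (Sum.inr k) hf)

variable (D)

/-- The subspace of the functions which vanish on `E`. -/
def vanishing (E : Set X) : Submodule ℂ D.H where
  carrier := {f | ∀ᵐ x ∂D.μ, x ∈ E → (f : Lp L2 2 D.μ) x = 0}
  zero_mem' := by
    filter_upwards [coeFn_zero (D := D)] with x hx _
    exact hx
  add_mem' {f g} hf hg := by
    filter_upwards [hf, hg, coeFn_add f g] with x hfx hgx hx hxE
    rw [hx, hfx hxE, hgx hxE, add_zero]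
  smul_mem' a f hf := by
    filter_upwards [hf, coeFn_smul a f] with x hfx hx hxE
    rw [hx, hfx hxE, smul_zero]

variable {D}

lemma mem_vanishing {E : Set X} {f : D.H} :
    f ∈ D.vanishing E ↔ ∀ᵐ x ∂D.μ, x ∈ E → (f : Lp L2 2 D.μ) x = 0 := Iff.rfl

lemma isClosed_vanishing (E : Set X) : IsClosed (D.vanishing E : Set D.H) :=
  (isClosed_setOf_ae_mem (s := fun x => {v : L2 | x ∈ E → v = 0}) fun _ =>
    isClosed_imp isOpen_const isClosed_singleton).preimage
      (continuous_subtype_val (p := fun f => f ∈ D.directIntegral))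

lemma isInvariant_vanishing {E : Set X} (hE : ∀ x, ∀ d ∈ Delta, x + d ∈ E ↔ x ∈ E) :
    IsInvariant (D.rep B) (D.vanishing E : Set D.H) := by
  refine D.isInvariant_of_gen_mem B (U := (D.vanishing E).restrictScalars ℝ)
    (isClosed_vanishing E) fun i f hf => ?_
  filter_upwards [gen_apply_eq_zero_iff i f, D.ae_shift (delta_mem (pos i)) hf] with x hgen hfx hx
  exact hgen.2 (hfx ((hE x _ (delta_mem _)).2 hx))

lemma vanishing_compl_eq_top {E : Set X} (hE : MeasurableSet E) (h : D.vanishing E = ⊥) :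
    D.vanishing Eᶜ = ⊤ := by
  refine Submodule.eq_top_iff'.2 fun f => ?_
  obtain ⟨g, hg⟩ := exists_ae_eq_of_memLp (D := D)
    ((Lp.memLp (f : Lp L2 2 D.μ)).indicator hE.compl) (by
      filter_upwards [ae_mem_fiber f] with x hx
      rcases Set.indicator_eq_zero_or_self Eᶜ (f : Lp L2 2 D.μ) x with h0 | hself
      exacts [h0 ▸ zero_mem _, hself ▸ hx])
  have hg0 : g = 0 := by
    rw [← Submodule.mem_bot ℂ, ← h, mem_vanishing]
    filter_upwards [hg] with x hx hxE
    rw [hx, Set.indicator_of_notMem (Set.notMem_compl_iff.2 hxE)]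
  rw [hg0] at hg
  filter_upwards [hg, coeFn_zero (D := D)] with x hx hx0 hxE
  rw [← Set.indicator_of_mem hxE (f : Lp L2 2 D.μ), ← hx, hx0]

lemma vanishing_eq_top_or_vanishing_compl_eq_top (h : IsIrreducibleOverC (D.rep B)) {E : Set X}
    (hE : MeasurableSet E) (hΔ : ∀ x, ∀ d ∈ Delta, x + d ∈ E ↔ x ∈ E) :
    D.vanishing E = ⊤ ∨ D.vanishing Eᶜ = ⊤ :=
  (h.2 _ (isClosed_vanishing E) (isInvariant_vanishing B hΔ)).symm.imp_right
    (vanishing_compl_eq_top hE)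

lemma exists_vanishing_compl_coset_eq_top (hd : IsDiscrete D.μ)
    (h : IsIrreducibleOverC (D.rep B)) : ∃ a, D.vanishing (coset a)ᶜ = ⊤ := by
  by_contra! hne
  have htop : ∀ a, D.vanishing (coset a) = ⊤ := fun a =>
    (vanishing_eq_top_or_vanishing_compl_eq_top B h (countable_coset a).measurableSet
      fun _ _ => add_mem_coset_iff).resolve_right (hne a)
  obtain ⟨f, hf⟩ := @exists_ne _ h.1 (0 : D.H)
  have hf0 : ∀ᵐ x ∂D.μ, (f : Lp L2 2 D.μ) x = 0 := hd.ae_iff.2 fun a ha =>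
    hd.ae_iff.1 (mem_vanishing.1 (htop a ▸ Submodule.mem_top)) a ha (mem_coset_self a)
  exact hf (ext_ae (EventuallyEq.trans hf0 coeFn_zero.symm))

lemma I_smul_mem {a : X} (ha : D.vanishing (coset a)ᶜ = ⊤) {U : Submodule ℝ D.H}
    (hc : IsClosed (U : Set D.H)) (hU : IsInvariant (D.rep B) (U : Set D.H)) {f : D.H}
    (hf : f ∈ U) : Complex.I • f ∈ U := by
  let F : ℕ → D.H := fun k => ((-1 : ℝ) ^ (a k).val) • parityOp k f
  have hF : ∀ k, ∀ᵐ x ∂D.μ, (F k : Lp L2 2 D.μ) x =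
      ((-1) ^ (a k).val * ((-1) ^ (x k).val * Complex.I)) • (f : Lp L2 2 D.μ) x := by
    intro k
    have hFk : F k = ((-1 : ℂ) ^ (a k).val) • parityOp k f := by
      rw [← Complex.ofReal_one, ← Complex.ofReal_neg, ← Complex.ofReal_pow, Complex.coe_smul]
    rw [hFk]
    filter_upwards [coeFn_smul ((-1) ^ (a k).val) (parityOp k f), parityOp_apply k f] with x hx hfx
    rw [hx, hfx, smul_smul]
  have hlim : Tendsto F atTop (𝓝 (Complex.I • f)) := by
    refine tendsto_of_dominated (f := f) (fun k => ?_) ?_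
    · filter_upwards [hF k] with x hx
      simp only [hx, norm_smul, norm_mul, norm_pow, norm_neg, norm_one, one_pow, Complex.norm_I,
        mul_one, one_mul, le_refl]
    · have hsupp : f ∈ D.vanishing (coset a)ᶜ := ha ▸ Submodule.mem_top
      filter_upwards [ae_all_iff.2 hF, coeFn_smul Complex.I f, mem_vanishing.1 hsupp]
        with x hFx hx hfx
      rw [hx]
      by_cases hxa : x ∈ coset a
      · refine tendsto_const_nhds.congr' ?_
        filter_upwards [eventually_eq_of_mem_coset hxa] with k hk
        rw [hFx, ← hk, ← mul_assoc, sign_sq, one_mul]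
      · simp only [hFx, hfx hxa, smul_zero, tendsto_const_nhds]
  exact hc.mem_of_tendsto hlim
    (Eventually.of_forall fun k => U.smul_mem _ (parityOp_mem B hU k hf))

theorem isIrreducibleOverR_of_isDiscrete (hd : IsDiscrete D.μ)
    (h : IsIrreducibleOverC (D.rep B)) : IsIrreducibleOverR (D.rep B) := by
  obtain ⟨a, ha⟩ := exists_vanishing_compl_coset_eq_top B hd h
  exact h.isIrreducibleOverR fun _ hc hU _ hf => I_smul_mem B ha hc hU hf

lemma exists_mem_ae_eq_smul {U : Submodule ℂ D.H} (hU : IsInvariant (D.rep B) (U : Set D.H))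
    (k : ℕ) (φ : ZMod 2 → ℂ) {f : D.H} (hf : f ∈ U) :
    ∃ g ∈ U, (g : Lp L2 2 D.μ) =ᵐ[D.μ] fun x => φ (x k) • (f : Lp L2 2 D.μ) x := by
  obtain ⟨α, β, hφ⟩ : ∃ α β : ℂ, ∀ c : ZMod 2, φ c = α + β * ((-1) ^ c.val * Complex.I) := by
    refine ⟨(φ 0 + φ 1) / 2, -Complex.I * (φ 0 - φ 1) / 2, fun c => ?_⟩
    have hI := Complex.I_mul_I
    fin_cases c
    · change φ 0 = _ + _ * ((-1) ^ 0 * Complex.I)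
      linear_combination (φ 0 - φ 1) / 2 * hI
    · change φ 1 = _ + _ * ((-1) ^ 1 * Complex.I)
      linear_combination -(φ 0 - φ 1) / 2 * hI
  refine ⟨α • f + β • parityOp k f,
    U.add_mem (U.smul_mem _ hf) (U.smul_mem _ (parityOp_mem B hU k hf)), ?_⟩
  filter_upwards [coeFn_add (α • f) (β • parityOp k f), coeFn_smul α f,
    coeFn_smul β (parityOp k f), parityOp_apply k f] with x hadd hα hβ hx
  rw [hadd, hα, hβ, hx, hφ, add_smul, mul_smul β]

lemma setIntegral_pi_inner_eq_zero {U : Submodule ℂ D.H}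
    (hU : IsInvariant (D.rep B) (U : Set D.H)) {g : D.H} (hg : g ∈ Uᗮ) (s : Finset ℕ)
    (t : ℕ → Set (ZMod 2)) : ∀ f ∈ U,
      ∫ x in (s : Set ℕ).pi t, inner ℂ ((f : Lp L2 2 D.μ) x) ((g : Lp L2 2 D.μ) x) ∂D.μ = 0 := by
  classical
  induction s using Finset.induction_on with
  | empty =>
    intro f hf
    rw [Finset.coe_empty, Set.empty_pi, setIntegral_univ, ← inner_eq_integral]
    exact hg f hf
  | insert k s _ ih =>
    intro f hf
    obtain ⟨f', hf', hff'⟩ := exists_mem_ae_eq_smul B hU k ((t k).indicator 1) hf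
    have hk : MeasurableSet ((fun x : X => x k) ⁻¹' t k) :=
      measurable_pi_apply k (Set.to_countable (t k)).measurableSet
    rw [Finset.coe_insert, Set.insert_pi, Set.inter_comm]
    change ∫ x in _ ∩ (fun x : X => x k) ⁻¹' t k, _ ∂D.μ = 0
    rw [← setIntegral_indicator hk, ← ih f' hf']
    refine integral_congr_ae (ae_restrict_of_ae ?_)
    filter_upwards [hff'] with x hx
    rw [hx]
    by_cases hxk : x k ∈ t k
    · have hx' : x ∈ (fun x : X => x k) ⁻¹' t k := hxk
      rw [Set.indicator_of_mem hxk, Set.indicator_of_mem hx', Pi.one_apply, one_smul]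
    · have hx' : x ∉ (fun x : X => x k) ⁻¹' t k := hxk
      rw [Set.indicator_of_notMem hxk, Set.indicator_of_notMem hx', zero_smul, inner_zero_left]

lemma ae_inner_eq_zero {U : Submodule ℂ D.H} (hU : IsInvariant (D.rep B) (U : Set D.H)) {f g : D.H}
    (hf : f ∈ U) (hg : g ∈ Uᗮ) :
    ∀ᵐ x ∂D.μ, inner ℂ ((f : Lp L2 2 D.μ) x) ((g : Lp L2 2 D.μ) x) = 0 :=
  ae_eq_zero_of_forall_setIntegral_pi_eq_zero
    (L2.integrable_inner (f : Lp L2 2 D.μ) (g : Lp L2 2 D.μ)) fun s t _ =>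
      setIntegral_pi_inner_eq_zero B hU hg s t f hf

lemma nontrivial_H (h : ¬∀ᵐ x ∂D.μ, D.ν x = 0) : Nontrivial D.H := by
  have hE : MeasurableSet {x | D.ν x ≠ 0} := D.measurable_ν (measurableSet_singleton 0).compl
  obtain ⟨E, hEm, hEν, hE0, hEtop⟩ :=
    D.μ.exists_subset_measure_lt_top hE (pos_iff_ne_zero.2 h)
  let e : L2 := lp.single 2 0 1
  have he : e ≠ 0 := fun h0 => one_ne_zero
    ((lp.single_apply_self 2 (0 : ℕ) (1 : ℂ)).symm.trans (congrArg (fun v : L2 => v 0) h0))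
  have hefib : ∀ n : ℕ∞, n ≠ 0 → e ∈ fiber n := fun n hn i hi =>
    lp.single_apply_ne 2 0 _ fun h0 => hn (by simpa [h0] using hi)
  obtain ⟨f, hf⟩ := exists_ae_eq_of_memLp (D := D)
    (memLp_indicator_const 2 hEm e (Or.inr hEtop.ne)) (Eventually.of_forall fun x => by
      by_cases hx : x ∈ E
      · rw [Set.indicator_of_mem hx]
        exact hefib _ (hEν hx)
      · rw [Set.indicator_of_notMem hx]
        exact zero_mem _)
  refine ⟨f, 0, fun hf0 => hE0.ne' (measure_eq_zero_iff_ae_notMem.2 ?_)⟩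
  rw [hf0] at hf
  filter_upwards [hf, coeFn_zero (D := D)] with x hx hx0 hxE
  exact he (by rw [← Set.indicator_of_mem hxE (fun _ => e), ← hx, hx0])

lemma measure_singleton_add_ne_zero {x d : X} (hx : D.μ {x} ≠ 0) (hd : d ∈ Delta) :
    D.μ {x + d} ≠ 0 := by
  intro h0
  refine hx (measure_mono_null ?_ ((D.quasiMeasurePreserving hd).preimage_null h0))
  exact Set.singleton_subset_iff.2 rfl

lemma exists_mem_apply_ne_zero {a : X} (ha : ∀ᵐ x ∂D.μ, x ∈ coset a) {U : Set D.H}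
    (hU : IsInvariant (D.rep B) U) {f : D.H} (hf : f ∈ U) (hf0 : f ≠ 0) {x : X}
    (hx : D.μ {x} ≠ 0) : ∃ g ∈ U, (g : Lp L2 2 D.μ) x ≠ 0 := by
  have hd := isDiscrete_of_ae_mem_coset ha
  obtain ⟨y, hy, hfy⟩ : ∃ y, D.μ {y} ≠ 0 ∧ (f : Lp L2 2 D.μ) y ≠ 0 := by
    by_contra! h
    exact hf0 (ext_ae (EventuallyEq.trans (hd.ae_iff.2 h) coeFn_zero.symm))
  have hstep : ∀ w ∈ {w | D.μ {w} ≠ 0 ∧ ∃ g ∈ U, (g : Lp L2 2 D.μ) w ≠ 0}, ∀ k,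
      w + delta k ∈ {w | D.μ {w} ≠ 0 ∧ ∃ g ∈ U, (g : Lp L2 2 D.μ) w ≠ 0} := by
    rintro w ⟨hw, g, hg, hgw⟩ k
    have hwk := measure_singleton_add_ne_zero hw (delta_mem k)
    refine ⟨hwk, D.gen (Sum.inl k) g, D.gen_mem_of_isInvariant B hU _ hg, fun h0 => hgw ?_⟩
    have h := (hd.ae_iff.1 (gen_apply_eq_zero_iff (Sum.inl k) g) _ hwk).1 h0
    rwa [pos, Sum.elim_inl, id_eq, add_add_self] at h
  have hyx : y + x ∈ Delta := by
    have h : (y + a) + (x + a) ∈ Delta :=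
      Delta.add_mem (hd.ae_iff.1 ha y hy) (hd.ae_iff.1 ha x hx)
    rwa [add_add_add_comm, add_self, add_zero] at h
  have hmem := add_mem_of_forall_add_delta_mem hstep hyx y ⟨hy, f, hf, hfy⟩
  rw [← add_assoc, add_self, zero_add] at hmem
  exact hmem.2

theorem isIrreducibleOverC_of_ae_mem_coset (hμ : D.μ ≠ 0) {a : X}
    (ha : ∀ᵐ x ∂D.μ, x ∈ coset a) (hν : ∀ᵐ x ∂D.μ, D.ν x = 1) :
    IsIrreducibleOverC (D.rep B) := by
  have hν0 : ¬∀ᵐ x ∂D.μ, D.ν x = 0 := fun h0 =>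
    hμ (ae_eq_bot.1 (eventually_false_iff_eq_bot.1 (by
      filter_upwards [h0, hν] with _ hx0 hx1 using zero_ne_one (hx0.symm.trans hx1))))
  refine ⟨nontrivial_H hν0, fun U hc hU => or_iff_not_imp_left.2 fun hne => ?_⟩
  have hd := isDiscrete_of_ae_mem_coset ha
  have : CompleteSpace U := hc.completeSpace_coe
  obtain ⟨f, hf, hf0⟩ := U.exists_mem_ne_zero_of_ne_bot hne
  rw [← Submodule.orthogonal_eq_bot_iff, Submodule.eq_bot_iff]
  intro g hg
  refine ext_ae (EventuallyEq.trans (hd.ae_iff.2 fun x hx => ?_) coeFn_zero.symm)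
  have hfib : ∀ u : D.H, (u : Lp L2 2 D.μ) x ∈ fiber 1 := fun u =>
    hd.ae_iff.1 hν x hx ▸ hd.ae_iff.1 (ae_mem_fiber u) x hx
  obtain ⟨f', hf', hf'x⟩ := exists_mem_apply_ne_zero B ha hU hf hf0 hx
  exact eq_zero_of_mem_fiber_one (hfib f') (hfib g) hf'x
    (hd.ae_iff.1 (ae_inner_eq_zero B hU hf' hg) x hx)

end Triple

lemma ae_fockMeasure_mem_coset : ∀ᵐ x ∂fockMeasure, x ∈ coset 0 :=
  (fockMeasure_eq_zero_iff _).2 fun _ hx hx0 => hx0 (add_mem hx (zero_mem _))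

lemma fockMeasure_ne_zero : fockMeasure ≠ 0 := fun h =>
  (fockMeasure_eq_zero_iff Set.univ).1 (by rw [h, Measure.coe_zero, Pi.zero_apply]) 0 (zero_mem _)
    (Set.mem_univ 0)

lemma isIrreducibleOverC_fermiFock {Z : Type*} [NormedAddCommGroup Z] [InnerProductSpace ℝ Z]
    [CompleteSpace Z] (B : UnitaryBasis Z) : IsIrreducibleOverC (fermiFock.rep B) :=
  Triple.isIrreducibleOverC_of_ae_mem_coset B fockMeasure_ne_zero ae_fockMeasure_mem_coset
    (Eventually.of_forall fun _ => rfl)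

end GW

end

theorem corollary3p7 {Z : Type*} [NormedAddCommGroup Z] [InnerProductSpace ℝ Z]
    [CompleteSpace Z] (B : GW.UnitaryBasis Z) :
    (∀ D : GW.Triple, GW.IsDiscrete D.μ → GW.IsIrreducibleOverC (D.rep B) →
      GW.IsIrreducibleOverR (D.rep B)) ∧
    GW.IsIrreducibleOverC (GW.fermiFock.rep B) ∧
    GW.IsIrreducibleOverR (GW.fermiFock.rep B) ∧
    ¬ ∃ V : Submodule ℝ GW.fermiFock.H, GW.IsInvariantRealForm (GW.fermiFock.rep B) V :=
  have hC := GW.isIrreducibleOverC_fermiFock B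
  have hR := GW.Triple.isIrreducibleOverR_of_isDiscrete B
    (GW.isDiscrete_of_ae_mem_coset GW.ae_fockMeasure_mem_coset) hC
  ⟨fun _ hd h => GW.Triple.isIrreducibleOverR_of_isDiscrete B hd h, hC, hR,
    fun ⟨V, hV⟩ => hR.not_isInvariantRealForm V hV⟩
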